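/- Let $(\breve N,\breve g,\breve P)$ be a locally Golden semi-Riemannian manifold: $\breve g$ is a semi-Riemannian metric with Levi-Civita connection $\breve\nabla$, and $\breve P$ is a smooth $(1,1)$-tensor field with $\breve P^2=\breve P+I$, $\breve g(\breve PX,Y)=\breve g(X,\breve PY)$ and $\breve\nabla\breve P=0$. Let $\acute N$ be an immersed submanifold whose radical distribution $\mathrm{Rad}\,T\acute N=T\acute N\cap T\acute N^{\perp}$ has constant rank $r\ge 1$. Choose a screen distribution $S(T\acute N)$ (a smooth complement of $\mathrm{Rad}\,T\acute N$ in $T\acute N$), a screen transversal bundle $S(T\acute N^{\perp})$ (a smooth complement of $\mathrm{Rad}\,T\acute N$ in $T\acute N^\perp$), and a smooth bundle $\mathrm{ltr}\,T\acute N$ of rank $r$, orthogonal to $S(T\acute N)$ and to $S(T\acute N^\perp)$, such that $$T\breve N|_{\acute N}=S(T\acute N)\oplus \mathrm{Rad}\,T\acute N\oplus \mathrm{ltr}\,T\acute N\oplus S(T\acute N^{\perp}).$$ (Then $\breve g$ pairs $\mathrm{ltr}\,T\acute N$ nondegenerately with $\mathrm{Rad}\,T\acute N$. The lightlike transversal bundle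 is a bundle of this kind; $\mathrm{ltr}\,T\acute N$ need not be totally isotropic.) Components of vectors are taken in this decomposition. Suppose that $\acute N$ is radical transversal, i.e. $\breve P(\mathrm{Rad}\,T\acute N)=\mathrm{ltr}\,T\acute N$ and $\breve P(S(T\acute N))=S(T\acute N)$. For $W,U\in\Gamma(S(T\acute N))$ let $\nabla_WU$ be the component of $\breve\nabla_WU$ in $T\acute N=S(T\acute N)\oplus\mathrm{Rad}\,T\acute N$, let $h^*(W,U)$ be the $\mathrm{Rad}\,T\acute N$-component of $\nabla_WU$, and let $h^l(W,U)$ be the $\mathrm{ltr}\,T\acute N$-component of $\breve\nabla_WU$. Say that $S(T\acute N)$ defines a totally geodesic foliation on $\acute N$ if it is involutive and $\nabla_WU\in\Gamma(S(T\acute N))$ for all $W,U\in\Gamma(S(T\acute N))$. For $n\in\mathrm{ltr}\,T\acute N$ let $K_2n$ be the $\mathrm{Rad}\,T\acute N$-component of $\breve Pn$. Then $S(T\acute N)$ defines a totally geodesic foliation on $\acute N$ if and only if at least one of the following holds: (a) for every $n\in \mathrm{ltr}\,T\acute N$, the vector $\breve Pn$ has no $\mathrm{ltr}\,T\acute N$-component;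 (b) $h^*(W,\breve PU)+K_2h^l(W,\breve PU)=h^*(W,U)+K_2h^l(W,U)$ for all $W,U\in\Gamma(S(T\acute N))$. The same equivalence also holds if $K_2$ in (b) denotes instead the projection of $T\breve N|_{\acute N}$ onto $\mathrm{Rad}\,T\acute N$ itself (so that $K_2h^l=0$). -/

import Mathlib

open scoped Manifold ContDiff Topology

noncomputable section

namespace GoldenLightlike

/-! ## The ambient manifold: metric, Levi-Civita connection, Golden structure -/

section Ambient

variable {E : Type*} [NormedAddCommGroup E] [NormedSpace ℝ E]
  (N : Type*) [TopologicalSpace N] [ChartedSpace E N] [IsManifold 𝓘(ℝ, E) ∞ N]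

/-- A smooth semi-Riemannian metric: a smooth field of nondegenerate symmetric bilinear forms.
(Its index is then locally constant.) -/
structure SemiRiemannianMetric where
  /-- The scalar product of each tangent space. -/
  inner (p : N) : TangentSpace 𝓘(ℝ, E) p →L[ℝ] TangentSpace 𝓘(ℝ, E) p →L[ℝ] ℝ
  symm (p : N) (v w : TangentSpace 𝓘(ℝ, E) p) : inner p v w = inner p w v
  nondegenerate (p : N) (v : TangentSpace 𝓘(ℝ, E) p) (hv : ∀ w, inner p v w = 0) : v = 0
  contMDiff : ContMDiff 𝓘(ℝ, E) (𝓘(ℝ, E).prod 𝓘(ℝ, E →L[ℝ] E →L[ℝ] ℝ)) ∞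
    (fun p ↦ Bundle.TotalSpace.mk' (E →L[ℝ] E →L[ℝ] ℝ) p (inner p))

variable {N}

/-- The vector field with constant components `a` in the preferred chart at `p` (zero outside the
domain of that chart). At `p` itself its value is `a`. For `a` in a basis of `E` these are the
coordinate vector fields of that chart. -/
def coordField (p : N) (a : E) (q : N) : TangentSpace 𝓘(ℝ, E) q :=
  (trivializationAt E (TangentSpace 𝓘(ℝ, E) : N → Type _) p).symm q a

/-- The components of the tangent vector `v` at `q` in the preferred chart at `p`. -/
def coord (p q : N) (v : TangentSpace 𝓘(ℝ, E) q) : E :=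
  (trivializationAt E (TangentSpace 𝓘(ℝ, E) : N → Type _) p ⟨q, v⟩).2

namespace SemiRiemannianMetric

variable (g : SemiRiemannianMetric (E := E) N)

/-- The metric at a point as a bilinear form; `T_p N` is `E` in the preferred chart at `p`. -/
def bilin (p : N) : LinearMap.BilinForm ℝ E :=
  LinearMap.mk₂ ℝ (fun v w : E ↦ (g.inner p v w : ℝ))
    (fun v v' w ↦ congrArg (fun l : E →L[ℝ] ℝ ↦ l w) ((g.inner p).map_add v v'))
    (fun c v w ↦ congrArg (fun l : E →L[ℝ] ℝ ↦ l w) ((g.inner p).map_smul c v))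
    (fun v w w' ↦ (g.inner p v).map_add w w')
    (fun c v w ↦ (g.inner p v).map_smul c w)

lemma bilin_nondegenerate (p : N) : (g.bilin p).Nondegenerate :=
  ⟨fun v hv ↦ g.nondegenerate p v hv,
    fun w hw ↦ g.nondegenerate p w fun v ↦ (g.symm p w v).trans (hw v)⟩

/-- `∂_a (g(∂_b, ∂_c))` at `p`, for the coordinate fields of the preferred chart at `p`. -/
def dCoeff (p : N) (a b c : E) : ℝ :=
  mvfderiv 𝓘(ℝ, E) (fun q : N ↦ (g.inner q (coordField p b q) (coordField p c q) : ℝ)) p a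

variable [FiniteDimensional ℝ E]

/-- The Christoffel symbols at `p` of the Levi-Civita connection, in the preferred chart at `p`:
`g(Γ(a,b), c) = (∂_a g(∂_b,∂_c) + ∂_b g(∂_a,∂_c) - ∂_c g(∂_a,∂_b)) / 2`. -/
def christoffel (p : N) (a b : E) : E :=
  ((g.bilin p).toDual (g.bilin_nondegenerate p)).symm
    (∑ i, ((g.dCoeff p a b (Module.finBasis ℝ E i) + g.dCoeff p b a (Module.finBasis ℝ E i)
      - g.dCoeff p (Module.finBasis ℝ E i) a b) / 2) • (Module.finBasis ℝ E).coord i)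

variable {F : Type*} [NormedAddCommGroup F] [NormedSpace ℝ F]
  {M : Type*} [TopologicalSpace M] [ChartedSpace F M]

/-- The Levi-Civita connection acting on vector fields `V` along a map `f : M → N` (the pull-back
connection): `(∇_w V)^k = w(V^k) + Γ^k_{ij} (f_* w)^i V^j` in the preferred chart at `f x`. -/
def nablaAlong (f : M → N) (V : ∀ x, TangentSpace 𝓘(ℝ, E) (f x)) (x : M)
    (w : TangentSpace 𝓘(ℝ, F) x) : TangentSpace 𝓘(ℝ, E) (f x) :=
  mvfderiv 𝓘(ℝ, F) (fun y ↦ coord (f x) (f y) (V y)) x w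
    + g.christoffel (f x) (mfderiv 𝓘(ℝ, F) 𝓘(ℝ, E) f x w) (V x)

/-- The Levi-Civita connection on vector fields of `N`. -/
def nabla (Y : ∀ p : N, TangentSpace 𝓘(ℝ, E) p) (p : N) (v : TangentSpace 𝓘(ℝ, E) p) :
    TangentSpace 𝓘(ℝ, E) p :=
  g.nablaAlong (fun q : N ↦ q) Y p v

end SemiRiemannianMetric

variable [FiniteDimensional ℝ E]

/-- A Golden structure compatible with `g`: a smooth `(1,1)`-tensor field `P` with `P² = P + I`
and `g(PW, U) = g(W, PU)`. Together with it, `(N, g)` is a Golden semi-Riemannian manifold. -/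
structure GoldenStructure (g : SemiRiemannianMetric (E := E) N) where
  /-- The endomorphism of each tangent space. -/
  toFun (p : N) : TangentSpace 𝓘(ℝ, E) p →L[ℝ] TangentSpace 𝓘(ℝ, E) p
  contMDiff : ContMDiff 𝓘(ℝ, E) (𝓘(ℝ, E).prod 𝓘(ℝ, E →L[ℝ] E)) ∞
    (fun p ↦ Bundle.TotalSpace.mk' (E →L[ℝ] E) p (toFun p))
  golden (p : N) (v : TangentSpace 𝓘(ℝ, E) p) : toFun p (toFun p v) = toFun p v + v
  compatible (p : N) (v w : TangentSpace 𝓘(ℝ, E) p) :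
    g.inner p (toFun p v) w = g.inner p v (toFun p w)

/-- The Golden structure is locally Golden: parallel for the Levi-Civita connection,
`∇_v (P Y) = P (∇_v Y)` for every tangent vector `v` at `p` and vector field `Y` smooth near `p`. -/
def GoldenStructure.IsLocallyGolden {g : SemiRiemannianMetric (E := E) N}
    (P : GoldenStructure g) : Prop :=
  ∀ (p : N) (v : TangentSpace 𝓘(ℝ, E) p) (Y : ∀ q : N, TangentSpace 𝓘(ℝ, E) q),
    (∃ u ∈ 𝓝 p, ContMDiffOn 𝓘(ℝ, E) (𝓘(ℝ, E).prod 𝓘(ℝ, E)) ∞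
      (fun q ↦ (⟨q, Y q⟩ : TangentBundle 𝓘(ℝ, E) N)) u) →
    g.nabla (fun q ↦ P.toFun q (Y q)) p v = P.toFun p (g.nabla Y p v)

end Ambient

/-! ## Lightlike submanifolds -/

section Submanifold

variable {E : Type*} [NormedAddCommGroup E] [NormedSpace ℝ E] [FiniteDimensional ℝ E]
  {N : Type*} [TopologicalSpace N] [ChartedSpace E N] [IsManifold 𝓘(ℝ, E) ∞ N]
  {F : Type*} [NormedAddCommGroup F] [NormedSpace ℝ F]
  {M : Type*} [TopologicalSpace M] [ChartedSpace F M] [IsManifold 𝓘(ℝ, F) ∞ M]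

/-- The family `D` of subspaces of the spaces `T_{f x} N` is a smooth vector bundle of rank `k`
over `M`: locally it has a smooth frame of length `k`. -/
def IsSmoothSubbundle (f : M → N) (D : ∀ x, Submodule ℝ (TangentSpace 𝓘(ℝ, E) (f x)))
    (k : ℕ) : Prop :=
  ∀ x₀ : M, ∃ u ∈ 𝓝 x₀, ∃ s : Fin k → ∀ x, TangentSpace 𝓘(ℝ, E) (f x),
    (∀ i, ContMDiffOn 𝓘(ℝ, F) (𝓘(ℝ, E).prod 𝓘(ℝ, E)) ∞
      (fun x ↦ (⟨f x, s i x⟩ : TangentBundle 𝓘(ℝ, E) N)) u) ∧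
    ∀ x ∈ u, LinearIndependent ℝ (fun i ↦ s i x) ∧
      Submodule.span ℝ (Set.range fun i ↦ s i x) = D x

/-- `V ∈ Γ(D)`: a smooth vector field along `f` with values in `D`. -/
def IsSection (f : M → N) (D : ∀ x, Submodule ℝ (TangentSpace 𝓘(ℝ, E) (f x)))
    (V : ∀ x, TangentSpace 𝓘(ℝ, E) (f x)) : Prop :=
  ContMDiff 𝓘(ℝ, F) (𝓘(ℝ, E).prod 𝓘(ℝ, E)) ∞
    (fun x ↦ (⟨f x, V x⟩ : TangentBundle 𝓘(ℝ, E) N)) ∧ ∀ x, V x ∈ D x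

/-- The tangent bundle of the immersed submanifold `f : M → N`, inside `TN` along `f`. -/
def tangent (f : M → N) (x : M) : Submodule ℝ (TangentSpace 𝓘(ℝ, E) (f x)) :=
  LinearMap.range (mfderiv 𝓘(ℝ, F) 𝓘(ℝ, E) f x).toLinearMap

/-- The vector field along `f` given by a vector field of `M`. -/
def push (f : M → N) (W : ∀ x : M, TangentSpace 𝓘(ℝ, F) x) (x : M) : TangentSpace 𝓘(ℝ, E) (f x) :=
  mfderiv 𝓘(ℝ, F) 𝓘(ℝ, E) f x (W x)

variable (g : SemiRiemannianMetric (E := E) N) (f : M → N)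

/-- The normal bundle of the submanifold, `{u | g(u, v) = 0 for all tangent v}`. -/
def normal (x : M) : Submodule ℝ (TangentSpace 𝓘(ℝ, E) (f x)) where
  carrier := {u | ∀ v ∈ tangent (F := F) f x, g.inner (f x) u v = 0}
  zero_mem' v _ := by rw [map_zero]; rfl
  add_mem' {a b} ha hb v hv := by
    rw [map_add]
    exact (congrArg₂ (· + ·) (ha v hv) (hb v hv)).trans (add_zero 0)
  smul_mem' c a ha v hv := by
    rw [map_smul]
    exact (congrArg (c * ·) (ha v hv)).trans (mul_zero c)

/-- The radical distribution `Rad = T ∩ T^⊥`. -/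
def radical (x : M) : Submodule ℝ (TangentSpace 𝓘(ℝ, E) (f x)) :=
  tangent (F := F) f x ⊓ normal (F := F) g f x

/-- The four summands of `TN` along a lightlike submanifold. -/
inductive Piece
  | screen
  | rad
  | ltr
  | screenTrans
  deriving DecidableEq

/-- Four subspaces as a family indexed by the names of the summands. -/
def summands {V : Type*} [AddCommGroup V] [Module ℝ V] (S R L Z : Submodule ℝ V) :
    Piece → Submodule ℝ V
  | .screen => S
  | .rad => R
  | .ltr => L
  | .screenTrans => Z

/-- The component of `v` in the summand `i` of an internal direct sum. -/
def component {V : Type*} [AddCommGroup V] [Module ℝ V] {A : Piece → Submodule ℝ V}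
    (h : DirectSum.IsInternal A) (i : Piece) (v : V) : V :=
  ((LinearEquiv.ofBijective (DirectSum.coeLinearMap A) (show Function.Bijective _ from h)).symm v i :
    A i)

lemma component_mem {V : Type*} [AddCommGroup V] [Module ℝ V] {A : Piece → Submodule ℝ V}
    (h : DirectSum.IsInternal A) (i : Piece) (v : V) : component h i v ∈ A i :=
  Subtype.property _

lemma component_sum {V : Type*} [AddCommGroup V] [Module ℝ V] {A : Piece → Submodule ℝ V}
    (h : DirectSum.IsInternal A) (v : V) :
    component h .screen v + component h .rad v + component h .ltr v + component h .screenTrans v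
      = v := by
  classical
  let e := LinearEquiv.ofBijective (DirectSum.coeLinearMap A) (show Function.Bijective _ from h)
  have : Fintype Piece := ⟨{.screen, .rad, .ltr, .screenTrans}, by intro i; cases i <;> simp⟩
  have hu : (Finset.univ : Finset Piece) = {.screen, .rad, .ltr, .screenTrans} := by
    ext i; cases i <;> simp
  have key : ∀ w : DirectSum Piece fun i ↦ A i, DirectSum.coeLinearMap A w =
      (w .screen : V) + w .rad + w .ltr + w .screenTrans := by
    intro w
    rw [DirectSum.coeLinearMap_eq_dfinsuppSum, DFinsupp.sum_eq_sum_fintype _ (by simp), hu]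
    simp [Finset.sum_insert, add_assoc]
  exact (key (e.symm v)).symm.trans (e.apply_symm_apply v)

/-- A lightlike submanifold `f : M → N` of `(N, g)` together with a screen distribution, a screen
transversal bundle and a lightlike transversal bundle. It is required that the radical distribution
has constant rank `r ≥ 1`, `T = Rad ⊥ screen`, `T^⊥ = Rad ⊥ screenTrans` and
`TN|_M = screen ⊥ (Rad ⊕ ltr) ⊥ screenTrans`. It follows that `screen` and `screenTrans` are
nondegenerate, and that `g` pairs `ltr` with `Rad` nondegenerately: each local frame `ξ_i` of `Rad`
has a dual local frame `N_i` of `ltr`, `g(N_i, ξ_j) = δ_ij`.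
The lightlike transversal bundles that are moreover totally isotropic, `g(N_i, N_j) = 0`, are
among these `ltr`; isotropy of `ltr` is not required. -/
structure LightlikeSubmanifold where
  immersion : Manifold.IsImmersion 𝓘(ℝ, F) 𝓘(ℝ, E) ∞ f
  /-- The rank of the radical distribution. -/
  r : ℕ
  one_le_r : 1 ≤ r
  radical_smooth : IsSmoothSubbundle (F := F) f (radical (F := F) g f) r
  /-- The screen distribution. -/
  screen (x : M) : Submodule ℝ (TangentSpace 𝓘(ℝ, E) (f x))
  screen_smooth : ∃ k, IsSmoothSubbundle (F := F) f screen k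
  radical_sup_screen (x : M) : radical (F := F) g f x ⊔ screen x = tangent (F := F) f x
  radical_disjoint_screen (x : M) : Disjoint (radical (F := F) g f x) (screen x)
  /-- The screen transversal bundle. -/
  screenTrans (x : M) : Submodule ℝ (TangentSpace 𝓘(ℝ, E) (f x))
  screenTrans_smooth : ∃ k, IsSmoothSubbundle (F := F) f screenTrans k
  radical_sup_screenTrans (x : M) :
    radical (F := F) g f x ⊔ screenTrans x = normal (F := F) g f x
  radical_disjoint_screenTrans (x : M) : Disjoint (radical (F := F) g f x) (screenTrans x)
  /-- The lightlike transversal bundle. -/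
  ltr (x : M) : Submodule ℝ (TangentSpace 𝓘(ℝ, E) (f x))
  ltr_smooth : IsSmoothSubbundle (F := F) f ltr r
  ltr_orthogonal_screen (x : M) (n) (hn : n ∈ ltr x) (s) (hs : s ∈ screen x) :
    g.inner (f x) n s = 0
  ltr_orthogonal_screenTrans (x : M) (n) (hn : n ∈ ltr x) (z) (hz : z ∈ screenTrans x) :
    g.inner (f x) n z = 0
  isInternal (x : M) : DirectSum.IsInternal
    (summands (screen x) (radical (F := F) g f x) (ltr x) (screenTrans x))

namespace LightlikeSubmanifold

variable {g f} (L : LightlikeSubmanifold (F := F) g f)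

/-- The component of a vector `v ∈ T_{f x} N` in a summand, with respect to
`TN|_M = screen ⊕ Rad ⊕ ltr ⊕ screenTrans`. -/
def comp (x : M) (i : Piece) (v : TangentSpace 𝓘(ℝ, E) (f x)) : TangentSpace 𝓘(ℝ, E) (f x) :=
  component (L.isInternal x) i v

/-- The induced connection `∇_w V`: the tangential part of the ambient derivative. -/
def nabla (V : ∀ x, TangentSpace 𝓘(ℝ, E) (f x)) (x : M) (w : TangentSpace 𝓘(ℝ, F) x) :
    TangentSpace 𝓘(ℝ, E) (f x) :=
  L.comp x .screen (g.nablaAlong f V x w) + L.comp x .rad (g.nablaAlong f V x w)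

/-- The lightlike second fundamental form `h^l(w, V)`: the `ltr`-part of the ambient derivative. -/
def hl (V : ∀ x, TangentSpace 𝓘(ℝ, E) (f x)) (x : M) (w : TangentSpace 𝓘(ℝ, F) x) :
    TangentSpace 𝓘(ℝ, E) (f x) :=
  L.comp x .ltr (g.nablaAlong f V x w)

/-- `h^*(w, V)`, for `V` a section of the screen distribution: the radical part of `∇_w V` in
`∇_w V = ∇^*_w V + h^*(w, V)`. -/
def hstar (V : ∀ x, TangentSpace 𝓘(ℝ, E) (f x)) (x : M) (w : TangentSpace 𝓘(ℝ, F) x) :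
    TangentSpace 𝓘(ℝ, E) (f x) :=
  L.comp x .rad (L.nabla V x w)

/-- The screen distribution defines a totally geodesic foliation of `M`: it is involutive, and
`∇_W U ∈ Γ(screen)` for all `W, U ∈ Γ(screen)`. -/
def ScreenDefinesTotallyGeodesicFoliation : Prop :=
  (∀ W U : ∀ x : M, TangentSpace 𝓘(ℝ, F) x,
    ContMDiff 𝓘(ℝ, F) (𝓘(ℝ, F).prod 𝓘(ℝ, F)) ∞
      (fun x ↦ (⟨x, W x⟩ : TangentBundle 𝓘(ℝ, F) M)) →
    ContMDiff 𝓘(ℝ, F) (𝓘(ℝ, F).prod 𝓘(ℝ, F)) ∞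
      (fun x ↦ (⟨x, U x⟩ : TangentBundle 𝓘(ℝ, F) M)) →
    (∀ x, push (E := E) f W x ∈ L.screen x) → (∀ x, push (E := E) f U x ∈ L.screen x) →
    ∀ x, push (E := E) f (VectorField.mlieBracket 𝓘(ℝ, F) W U) x ∈ L.screen x) ∧
  ∀ W : ∀ x : M, TangentSpace 𝓘(ℝ, F) x,
    ContMDiff 𝓘(ℝ, F) (𝓘(ℝ, F).prod 𝓘(ℝ, F)) ∞
      (fun x ↦ (⟨x, W x⟩ : TangentBundle 𝓘(ℝ, F) M)) →
    (∀ x, push (E := E) f W x ∈ L.screen x) →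
    ∀ U, IsSection (F := F) f L.screen U → ∀ x, L.nabla U x (W x) ∈ L.screen x

/-- Radical transversal lightlike submanifold of a Golden semi-Riemannian manifold:
`P Rad = ltr` and `P screen = screen`. -/
def IsRadicalTransversal (P : GoldenStructure g) : Prop :=
  ∀ x, (radical (F := F) g f x).map (P.toFun (f x)).toLinearMap = L.ltr x ∧
    (L.screen x).map (P.toFun (f x)).toLinearMap = L.screen x

/-- `P n` has no component in `ltr`, for all `n ∈ ltr`. -/
def NoLtrComponent (P : GoldenStructure g) : Prop :=
  ∀ x, ∀ n ∈ L.ltr x, L.comp x .ltr (P.toFun (f x) n) = 0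

/-- `h^*(W, PU) + K h^l(W, PU) = h^*(W, U) + K h^l(W, U)` for all `W, U ∈ Γ(screen)`, where `K` is
a given field of maps on `TN|_M`. -/
def ScreenEquation (P : GoldenStructure g)
    (K : ∀ x, TangentSpace 𝓘(ℝ, E) (f x) → TangentSpace 𝓘(ℝ, E) (f x)) : Prop :=
  ∀ W : ∀ x : M, TangentSpace 𝓘(ℝ, F) x,
    ContMDiff 𝓘(ℝ, F) (𝓘(ℝ, F).prod 𝓘(ℝ, F)) ∞
      (fun x ↦ (⟨x, W x⟩ : TangentBundle 𝓘(ℝ, F) M)) →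
    (∀ x, push (E := E) f W x ∈ L.screen x) →
    ∀ U, IsSection (F := F) f L.screen U → ∀ x,
      L.hstar (fun y ↦ P.toFun (f y) (U y)) x (W x)
          + K x (L.hl (fun y ↦ P.toFun (f y) (U y)) x (W x))
        = L.hstar U x (W x) + K x (L.hl U x (W x))

end LightlikeSubmanifold

end Submanifold

end GoldenLightlike

end

/-! Write `v` for the ambient derivative of `U` along `W`, with radical part `ρ = h^*(W,U)` and
`ltr` part `λ = h^l(W,U)`. Since `P` is parallel, the derivative of `PU` along `W` is `Pv`
(`IsLocallyGolden.nablaAlong_apply`). The structure `P` preserves the screen by assumption and the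
screen transversal bundle by self-adjointness. It maps `Rad` onto `ltr`, and for `n = Pξ` in `ltr`
the Golden relation gives `Pn = n + ξ`. Hence `Pv` has radical part `P⁻¹λ` and `ltr` part `Pρ + λ`
(`comp_apply`, `apply_hstar_apply`).

Since `Pn = n + ξ`, the `ltr` part of `Pn` is `n` itself. As the radical has positive rank,
condition (a) therefore forces the submanifold to be empty (`isEmpty_of_noLtrComponent`), so the
content lies in (b). Because the connection has no torsion, a totally geodesic screen foliation
amounts to `h^* = 0`, involutivity then being automatic (`push_mlieBracket`).

Applying the injective map `P` turns (b) into `λ = 0` when `K₂` is the radical part of `P`, and into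
`λ = Pρ` when `K₂` is the radical projection. Testing it on both `U` and `PU` yields `ρ = 0` in
either case (`screenRadicalFlat_iff`, `screenRadicalFlat_iff'`). -/

noncomputable section

namespace GoldenLightlike

/-! ### Derivatives of vector-valued functions, read in charts -/

section Calculus

variable {F : Type*} [NormedAddCommGroup F] [NormedSpace ℝ F]
  {M : Type*} [TopologicalSpace M] [ChartedSpace F M]
  {G : Type*} [NormedAddCommGroup G] [NormedSpace ℝ G]
  {G' : Type*} [NormedAddCommGroup G'] [NormedSpace ℝ G']

lemma mvfderiv_eq_fderiv_chart {h : M → G} {x : M} (hh : MDifferentiableAt 𝓘(ℝ, F) 𝓘(ℝ, G) h x) :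
    mvfderiv 𝓘(ℝ, F) h x =
      fderiv ℝ (h ∘ (extChartAt 𝓘(ℝ, F) x).symm) (extChartAt 𝓘(ℝ, F) x x) := by
  have h1 : mfderiv 𝓘(ℝ, F) 𝓘(ℝ, G) h x =
      fderiv ℝ (h ∘ (extChartAt 𝓘(ℝ, F) x).symm) (extChartAt 𝓘(ℝ, F) x x) := by
    refine hh.mfderiv.trans ?_
    refine (congrArg (fun s ↦ fderivWithin ℝ (h ∘ (extChartAt 𝓘(ℝ, F) x).symm) s
      (extChartAt 𝓘(ℝ, F) x x)) (ModelWithCorners.range_eq_univ 𝓘(ℝ, F))).trans ?_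
    exact congrFun fderivWithin_univ _
  exact h1

lemma differentiableAt_comp_chart_symm {h : M → G} {x : M}
    (hh : MDifferentiableAt 𝓘(ℝ, F) 𝓘(ℝ, G) h x) :
    DifferentiableAt ℝ (h ∘ (extChartAt 𝓘(ℝ, F) x).symm) (extChartAt 𝓘(ℝ, F) x x) := by
  have := ((mdifferentiableAt_iff _ _).1 hh).2
  rw [ModelWithCorners.range_eq_univ, differentiableWithinAt_univ] at this
  exact this

/-- The product rule for evaluation, transported from the normed space through the chart at `x`. -/
lemma mvfderiv_clm_apply {A : M → G →L[ℝ] G'} {c : M → G} {x : M}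
    (hA : MDifferentiableAt 𝓘(ℝ, F) 𝓘(ℝ, G →L[ℝ] G') A x)
    (hc : MDifferentiableAt 𝓘(ℝ, F) 𝓘(ℝ, G) c x) (w : TangentSpace 𝓘(ℝ, F) x) :
    mvfderiv 𝓘(ℝ, F) (fun y ↦ A y (c y)) x w =
      mvfderiv 𝓘(ℝ, F) A x w (c x) + A x (mvfderiv 𝓘(ℝ, F) c x w) := by
  rw [mvfderiv_eq_fderiv_chart (hA.clm_apply hc), mvfderiv_eq_fderiv_chart hA,
    mvfderiv_eq_fderiv_chart hc]
  have := fderiv_clm_apply (differentiableAt_comp_chart_symm hA)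
    (differentiableAt_comp_chart_symm hc)
  have h2 := congrArg (fun l : F →L[ℝ] G' ↦ l w) this
  simp only [Function.comp_apply, extChartAt_to_inv] at h2
  rw [add_comm]
  exact h2

lemma mvfderiv_congr {h k : M → G} {x : M} (hk : h =ᶠ[𝓝 x] k) :
    (mvfderiv 𝓘(ℝ, F) h x : TangentSpace 𝓘(ℝ, F) x →L[ℝ] G) = mvfderiv 𝓘(ℝ, F) k x :=
  hk.mfderiv_eq

end Calculus

/-! ### Parallelism of the Golden structure in coordinates and along maps -/

section Coordinates

variable {E : Type*} [NormedAddCommGroup E] [NormedSpace ℝ E]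
  {N : Type*} [TopologicalSpace N] [ChartedSpace E N] [IsManifold 𝓘(ℝ, E) ∞ N]

lemma coord_eq_mfderiv {p q : N} (hq : q ∈ (chartAt E p).source) (v : TangentSpace 𝓘(ℝ, E) q) :
    coord p q v = mfderiv 𝓘(ℝ, E) 𝓘(ℝ, E) (extChartAt 𝓘(ℝ, E) p) q v := by
  refine Eq.trans ?_ (congrArg (fun l : TangentSpace 𝓘(ℝ, E) q →L[ℝ] E ↦ l v)
    (TangentBundle.continuousLinearMapAt_trivializationAt (I := 𝓘(ℝ, E)) hq))
  exact (congrFun (Bundle.Trivialization.coe_linearMapAt_of_mem (R := ℝ)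
    (trivializationAt E (TangentSpace 𝓘(ℝ, E) : N → Type _) p) (by simpa using hq)) v).symm

lemma coord_self (p : N) (v : TangentSpace 𝓘(ℝ, E) p) : coord p p v = v := by
  rw [coord_eq_mfderiv (mem_chart_source E p), mfderiv_extChartAt_self]
  rfl

lemma coord_coordField {p q : N} (hq : q ∈ (chartAt E p).source) (a : E) :
    coord p q (coordField p a q) = a := by
  unfold coord coordField
  rw [Bundle.Trivialization.apply_mk_symm _ (by simpa using hq)]

lemma coordField_self (p : N) (a : E) : coordField p a p = a :=
  (coord_self (E := E) p (coordField p a p)).symm.trans (coord_coordField (mem_chart_source E p) a)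

lemma contMDiffOn_coordField (p : N) (a : E) :
    ContMDiffOn 𝓘(ℝ, E) (𝓘(ℝ, E).prod 𝓘(ℝ, E)) ∞
      (fun q ↦ (⟨q, coordField p a q⟩ : TangentBundle 𝓘(ℝ, E) N)) (chartAt E p).source := by
  have h := Bundle.Trivialization.contMDiffOn_symm (n := ∞) (IB := 𝓘(ℝ, E))
    (trivializationAt E (TangentSpace 𝓘(ℝ, E) : N → Type _) p)
  have h2 : ContMDiffOn 𝓘(ℝ, E) (𝓘(ℝ, E).prod 𝓘(ℝ, E)) ∞ (fun q : N ↦ (q, a))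
      (chartAt E p).source := contMDiffOn_id.prodMk contMDiffOn_const
  refine (h.comp h2 ?_).congr ?_
  · intro q hq
    simpa [Bundle.Trivialization.mem_target] using hq
  · intro q hq
    unfold coordField
    rw [Bundle.Trivialization.mk_symm _ (by simpa using hq)]
    rfl

variable {F : Type*} [NormedAddCommGroup F] [NormedSpace ℝ F]
  {M : Type*} [TopologicalSpace M] [ChartedSpace F M]

lemma contMDiffAt_coord {f : M → N} {V : ∀ x, TangentSpace 𝓘(ℝ, E) (f x)} {x : M}
    (hV : ContMDiffAt 𝓘(ℝ, F) (𝓘(ℝ, E).prod 𝓘(ℝ, E)) ∞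
      (fun y ↦ (⟨f y, V y⟩ : TangentBundle 𝓘(ℝ, E) N)) x) :
    ContMDiffAt 𝓘(ℝ, F) 𝓘(ℝ, E) ∞ (fun y ↦ coord (f x) (f y) (V y)) x :=
  (Bundle.contMDiffAt_totalSpace.1 hV).2

variable [FiniteDimensional ℝ E] {g : SemiRiemannianMetric (E := E) N} (P : GoldenStructure g)

namespace GoldenStructure

/-- The matrix of the Golden structure at `q` in the preferred chart at `p`. -/
def inCoord (p q : N) : E →L[ℝ] E :=
  ContinuousLinearMap.inCoordinates E (TangentSpace 𝓘(ℝ, E) : N → Type _) E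
    (TangentSpace 𝓘(ℝ, E) : N → Type _) p q p q (P.toFun q)

omit [FiniteDimensional ℝ E] in
lemma coord_apply {p q : N} (hq : q ∈ (chartAt E p).source) (v : TangentSpace 𝓘(ℝ, E) q) :
    coord p q (P.toFun q v) = P.inCoord p q (coord p q v) := by
  have hq' : q ∈ (trivializationAt E (TangentSpace 𝓘(ℝ, E) : N → Type _) p).baseSet := by
    simpa using hq
  rw [inCoord, ContinuousLinearMap.inCoordinates_eq hq' hq']
  simp only [ContinuousLinearMap.comp_apply]
  have : (((trivializationAt E (TangentSpace 𝓘(ℝ, E) : N → Type _) p).continuousLinearEquivAt ℝ q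
      hq').symm : E →L[ℝ] TangentSpace 𝓘(ℝ, E) q) (coord p q v) = v :=
    ((trivializationAt E (TangentSpace 𝓘(ℝ, E) : N → Type _) p).continuousLinearEquivAt ℝ q
      hq').symm_apply_apply v
  rw [this]
  rfl

omit [FiniteDimensional ℝ E] in
lemma contMDiffAt_inCoord (p : N) :
    ContMDiffAt 𝓘(ℝ, E) 𝓘(ℝ, E →L[ℝ] E) ∞ (P.inCoord p) p :=
  ((contMDiffAt_hom_bundle _).1 P.contMDiff.contMDiffAt).2

omit [FiniteDimensional ℝ E] in
lemma inCoord_self (p : N) (v : E) : P.inCoord p p v = P.toFun p v := by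
  have := P.coord_apply (mem_chart_source E p) v
  exact (congrArg (P.inCoord p p) (coord_self p v)).symm.trans (this.symm.trans (coord_self p _))

omit [FiniteDimensional ℝ E] in
lemma contMDiff_apply {f : M → N} (hf : ContMDiff 𝓘(ℝ, F) 𝓘(ℝ, E) ∞ f)
    {V : ∀ x, TangentSpace 𝓘(ℝ, E) (f x)}
    (hV : ContMDiff 𝓘(ℝ, F) (𝓘(ℝ, E).prod 𝓘(ℝ, E)) ∞
      (fun y ↦ (⟨f y, V y⟩ : TangentBundle 𝓘(ℝ, E) N))) :
    ContMDiff 𝓘(ℝ, F) (𝓘(ℝ, E).prod 𝓘(ℝ, E)) ∞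
      (fun y ↦ (⟨f y, P.toFun (f y) (V y)⟩ : TangentBundle 𝓘(ℝ, E) N)) := by
  intro x
  have h1 : ContMDiffAt 𝓘(ℝ, F) 𝓘(ℝ, E →L[ℝ] E) ∞ (fun y ↦ P.inCoord (f x) (f y)) x :=
    (P.contMDiffAt_inCoord (f x)).comp x (hf x)
  exact ContMDiffAt.clm_apply_of_inCoordinates h1 (hV x) (hf x)

/-- The covariant derivative of a parallel Golden structure, in the chart at `p`. -/
lemma IsLocallyGolden.mvfderiv_inCoord {P : GoldenStructure g} (hP : P.IsLocallyGolden) (p : N)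
    (v : TangentSpace 𝓘(ℝ, E) p) (a : E) :
    mvfderiv 𝓘(ℝ, E) (P.inCoord p) p v a + g.christoffel p v (P.toFun p a) =
      P.toFun p (g.christoffel p v a) := by
  have hs : (chartAt E p).source ∈ 𝓝 p := chart_source_mem_nhds E p
  -- A field with constant components has zero coordinate derivative, so parallelism tested on it
  -- isolates the derivative of the matrix of `P`.
  have key := hP p v (coordField p a) ⟨_, hs, contMDiffOn_coordField p a⟩
  have e1 : (fun q ↦ coord p q (P.toFun q (coordField p a q))) =ᶠ[𝓝 p]
      fun q ↦ P.inCoord p q a := by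
    filter_upwards [hs] with q hq
    rw [P.coord_apply hq, coord_coordField hq]
  have e2 : (fun q ↦ coord p q (coordField p a q)) =ᶠ[𝓝 p] fun _ ↦ a := by
    filter_upwards [hs] with q hq
    rw [coord_coordField hq]
  have hid : mfderiv 𝓘(ℝ, E) 𝓘(ℝ, E) (fun q : N ↦ q) p v = v := by
    rw [show (fun q : N ↦ q) = id from rfl, mfderiv_id]; rfl
  have hd := mvfderiv_clm_apply (A := P.inCoord p) (c := fun _ ↦ a)
    ((P.contMDiffAt_inCoord p).mdifferentiableAt (by simp)) mdifferentiableAt_const v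
  unfold SemiRiemannianMetric.nabla SemiRiemannianMetric.nablaAlong at key
  rw [mvfderiv_congr e1, mvfderiv_congr e2, hd, hid, mvfderiv_const] at key
  simp only [zero_apply, map_zero, add_zero, zero_add] at key
  have e3 : (coordField p a p : E) = a := coordField_self p a
  change (_ : E) + g.christoffel p v (P.toFun p (coordField p a p : E)) =
    P.toFun p (g.christoffel p v (coordField p a p : E)) at key
  rw [e3] at key
  exact key

/-- A parallel Golden structure commutes with the pull-back connection. -/
lemma IsLocallyGolden.nablaAlong_apply {P : GoldenStructure g} (hP : P.IsLocallyGolden)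
    {f : M → N} {x : M} (hf : ContMDiffAt 𝓘(ℝ, F) 𝓘(ℝ, E) ∞ f x)
    {V : ∀ x, TangentSpace 𝓘(ℝ, E) (f x)}
    (hV : ContMDiffAt 𝓘(ℝ, F) (𝓘(ℝ, E).prod 𝓘(ℝ, E)) ∞
      (fun y ↦ (⟨f y, V y⟩ : TangentBundle 𝓘(ℝ, E) N)) x) (w : TangentSpace 𝓘(ℝ, F) x) :
    g.nablaAlong f (fun y ↦ P.toFun (f y) (V y)) x w = P.toFun (f x) (g.nablaAlong f V x w) := by
  have e1 : (fun y ↦ coord (f x) (f y) (P.toFun (f y) (V y))) =ᶠ[𝓝 x]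
      fun y ↦ (P.inCoord (f x) ∘ f) y (coord (f x) (f y) (V y)) := by
    filter_upwards [hf.continuousAt (chart_source_mem_nhds E (f x))] with y hy
    exact P.coord_apply hy _
  have hA := (P.contMDiffAt_inCoord (f x)).mdifferentiableAt (by simp)
  have hf' := hf.mdifferentiableAt (by simp)
  have hd := mvfderiv_clm_apply (A := P.inCoord (f x) ∘ f) (c := fun y ↦ coord (f x) (f y) (V y))
    (hA.comp x hf') ((contMDiffAt_coord hV).mdifferentiableAt (by simp)) w
  -- Parallelism is assumed only for fields on `N`. Its coordinate form involves just the values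
  -- `f_* w` and `V x`, so it applies to `V` without extending `V` off the image of `f`.
  have hg := hP.mvfderiv_inCoord (f x) (mfderiv 𝓘(ℝ, F) 𝓘(ℝ, E) f x w) (V x)
  have hc : mvfderiv 𝓘(ℝ, F) (P.inCoord (f x) ∘ f) x w =
      mvfderiv 𝓘(ℝ, E) (P.inCoord (f x)) (f x) (mfderiv 𝓘(ℝ, F) 𝓘(ℝ, E) f x w) :=
    congrArg (fun l : F →L[ℝ] E →L[ℝ] E ↦ l w) (mfderiv_comp x hA hf')
  rw [hc, coord_self, Function.comp_apply, inCoord_self] at hd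
  unfold SemiRiemannianMetric.nablaAlong
  rw [mvfderiv_congr e1, hd]
  refine Eq.trans ?_ (map_add (P.toFun (f x)) _ _).symm
  rw [← hg]
  exact (add_right_comm _ _ _).trans (add_comm _ _)

end GoldenStructure

end Coordinates

end GoldenLightlike
end

noncomputable section

namespace GoldenLightlike

/-! ### Vanishing torsion along an immersed submanifold -/

section Torsion

/-- Both terms on the left contain the second derivative of `ψ` at `X z`, `Y z`; these cancel by
symmetry, leaving the derivatives of the fields. -/
lemma fderiv_fderiv_apply_sub {F G : Type*} [NormedAddCommGroup F] [NormedSpace ℝ F]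
    [NormedAddCommGroup G] [NormedSpace ℝ G] {ψ : F → G} {z : F} (hψ : ContDiffAt ℝ 2 ψ z)
    {X Y : F → F} (hX : DifferentiableAt ℝ X z) (hY : DifferentiableAt ℝ Y z) :
    fderiv ℝ (fun y ↦ fderiv ℝ ψ y (Y y)) z (X z) - fderiv ℝ (fun y ↦ fderiv ℝ ψ y (X y)) z (Y z) =
      fderiv ℝ ψ z (VectorField.lieBracket ℝ X Y z) := by
  have hd : DifferentiableAt ℝ (fderiv ℝ ψ) z :=
    (hψ.fderiv_right (m := 1) (by norm_num)).differentiableAt (by simp)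
  have hs : IsSymmSndFDerivAt ℝ ψ z := hψ.isSymmSndFDerivAt (by simp)
  rw [fderiv_clm_apply hd hY, fderiv_clm_apply hd hX, VectorField.lieBracket]
  simp only [add_apply, ContinuousLinearMap.comp_apply, ContinuousLinearMap.flip_apply, map_sub]
  rw [hs.eq (X z) (Y z)]
  abel

variable {E : Type*} [NormedAddCommGroup E] [NormedSpace ℝ E]
  {N : Type*} [TopologicalSpace N] [ChartedSpace E N] [IsManifold 𝓘(ℝ, E) ∞ N]

namespace SemiRiemannianMetric

variable (g : SemiRiemannianMetric (E := E) N)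

lemma dCoeff_comm (p : N) (a b c : E) : g.dCoeff p a b c = g.dCoeff p a c b := by
  unfold dCoeff
  simp_rw [fun q ↦ g.symm q (coordField p b q) (coordField p c q)]

variable [FiniteDimensional ℝ E]

/-- Symmetry of the metric swaps the first two terms of the Koszul expression and fixes the third.
-/
lemma christoffel_comm (p : N) (a b : E) : g.christoffel p a b = g.christoffel p b a := by
  unfold christoffel
  simp_rw [g.dCoeff_comm p _ a b, add_comm (g.dCoeff p a b _)]

end SemiRiemannianMetric

variable {F : Type*} [NormedAddCommGroup F] [NormedSpace ℝ F]
  {M : Type*} [TopologicalSpace M] [ChartedSpace F M] [IsManifold 𝓘(ℝ, F) ∞ M]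

/-- The components of a vector field of `M` in the preferred chart at `x`. -/
def localRep (x : M) (W : ∀ y : M, TangentSpace 𝓘(ℝ, F) y) (z : F) : F :=
  VectorField.mpullbackWithin 𝓘(ℝ, F) 𝓘(ℝ, F) (extChartAt 𝓘(ℝ, F) x).symm W
    (Set.range 𝓘(ℝ, F)) z

omit [IsManifold 𝓘(ℝ, F) ∞ M] in
lemma mfderiv_localRep [IsManifold 𝓘(ℝ, F) 1 M] (x : M) (W : ∀ y : M, TangentSpace 𝓘(ℝ, F) y) {z : F}
    (hz : z ∈ (extChartAt 𝓘(ℝ, F) x).target) :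
    mfderiv 𝓘(ℝ, F) 𝓘(ℝ, F) (extChartAt 𝓘(ℝ, F) x).symm z (localRep (F := F) x W z) =
      W ((extChartAt 𝓘(ℝ, F) x).symm z) := by
  have hi := isInvertible_mfderivWithin_extChartAt_symm (I := 𝓘(ℝ, F)) hz
  unfold localRep
  rw [VectorField.mpullbackWithin_apply, ← mfderivWithin_univ,
    ← ModelWithCorners.range_eq_univ 𝓘(ℝ, F)]
  exact hi.self_apply_inverse _

lemma localRep_self (x : M) (W : ∀ y : M, TangentSpace 𝓘(ℝ, F) y) :
    localRep x W (extChartAt 𝓘(ℝ, F) x x) = W x := by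
  have h : (W ((extChartAt 𝓘(ℝ, F) x).symm (extChartAt 𝓘(ℝ, F) x x)) : F) = W x :=
    congrArg (fun y ↦ (W y : F)) (extChartAt_to_inv x)
  refine Eq.trans ?_ (mfderivWithin_extChartAt_symm_inverse_apply (I := 𝓘(ℝ, F)) (W x))
  exact congrArg (fun v : F ↦ ((mfderivWithin 𝓘(ℝ, F) 𝓘(ℝ, F) (extChartAt 𝓘(ℝ, F) x).symm
    (Set.range 𝓘(ℝ, F)) (extChartAt 𝓘(ℝ, F) x x)).inverse v : F)) h

lemma differentiableAt_localRep [CompleteSpace F] (x : M) {W : ∀ y : M, TangentSpace 𝓘(ℝ, F) y}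
    (hW : ContMDiffAt 𝓘(ℝ, F) (𝓘(ℝ, F).prod 𝓘(ℝ, F)) ∞
      (fun x ↦ (⟨x, W x⟩ : TangentBundle 𝓘(ℝ, F) M)) x) :
    DifferentiableAt ℝ (localRep x W) (extChartAt 𝓘(ℝ, F) x x) := by
  have h := VectorField.contMDiffWithinAt_mpullbackWithin_extChartAt_symm (m := 1) (n := ∞)
    (s := Set.univ) ((hW.of_le (by simp)).contMDiffWithinAt) uniqueMDiffOn_univ (Set.mem_univ x)
    (WithTop.coe_le_coe.2 le_top)
  rw [contMDiffWithinAt_vectorSpace_iff_contDiffWithinAt] at h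
  refine (h.differentiableWithinAt (by simp)).differentiableAt ?_
  simpa using extChartAt_target_mem_nhds (I := 𝓘(ℝ, F)) x

lemma mlieBracket_eq_localRep (x : M) (W U : ∀ y : M, TangentSpace 𝓘(ℝ, F) y) :
    VectorField.mlieBracket 𝓘(ℝ, F) W U x =
      VectorField.lieBracket ℝ (localRep x W) (localRep x U) (extChartAt 𝓘(ℝ, F) x x) := by
  rw [← VectorField.mlieBracketWithin_univ, VectorField.mlieBracketWithin_apply,
    mfderiv_extChartAt_self]
  rw [Set.preimage_univ, Set.univ_inter]
  refine (congrArg (fun l : F →L[ℝ] F ↦ l (VectorField.lieBracketWithin ℝ (localRep x W)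
    (localRep x U) (Set.range 𝓘(ℝ, F)) (extChartAt 𝓘(ℝ, F) x x)))
    ContinuousLinearMap.inverse_id).trans ?_
  rw [ModelWithCorners.range_eq_univ, VectorField.lieBracketWithin_univ]
  rfl

variable {f : M → N}

/-- The chain rule: on a neighbourhood, and not only at `x`, a pushed-forward field is the
derivative of the chart expression of `f` applied to the components of `W`, so it can be
differentiated again. -/
lemma coord_push_eq (hf : ContMDiff 𝓘(ℝ, F) 𝓘(ℝ, E) ∞ f) (x : M)
    (W : ∀ y : M, TangentSpace 𝓘(ℝ, F) y) :
    ((fun y ↦ coord (f x) (f y) (push (E := E) f W y)) ∘ (extChartAt 𝓘(ℝ, F) x).symm)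
      =ᶠ[𝓝 (extChartAt 𝓘(ℝ, F) x x)]
      fun z ↦ fderiv ℝ (extChartAt 𝓘(ℝ, E) (f x) ∘ f ∘ (extChartAt 𝓘(ℝ, F) x).symm) z
        (localRep x W z) := by
  have hc : (extChartAt 𝓘(ℝ, F) x).symm ⁻¹' (f ⁻¹' (chartAt E (f x)).source) ∈
      𝓝 (extChartAt 𝓘(ℝ, F) x x) := by
    apply (continuousAt_extChartAt_symm x).preimage_mem_nhds
    rw [extChartAt_to_inv]
    exact hf.continuous.continuousAt.preimage_mem_nhds (chart_source_mem_nhds E (f x))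
  filter_upwards [hc, extChartAt_target_mem_nhds (I := 𝓘(ℝ, F)) x] with z hz hzt
  set y := (extChartAt 𝓘(ℝ, F) x).symm z with hy
  have hz' : f y ∈ (chartAt E (f x)).source := hz
  have h1 : MDifferentiableAt 𝓘(ℝ, E) 𝓘(ℝ, E) (extChartAt 𝓘(ℝ, E) (f x)) (f y) :=
    mdifferentiableAt_extChartAt hz'
  have h2 : MDifferentiableAt 𝓘(ℝ, F) 𝓘(ℝ, E) f y := hf.mdifferentiableAt (by simp)
  have h3 : MDifferentiableAt 𝓘(ℝ, F) 𝓘(ℝ, F) (extChartAt 𝓘(ℝ, F) x).symm z := by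
    have := mdifferentiableWithinAt_extChartAt_symm (I := 𝓘(ℝ, F)) hzt
    rwa [ModelWithCorners.range_eq_univ, mdifferentiableWithinAt_univ] at this
  have h4 := mfderiv_comp z (h1.comp y h2) h3
  have h5 := mfderiv_comp y h1 h2
  rw [← mfderiv_eq_fderiv]
  refine (coord_eq_mfderiv hz' _).trans (Eq.symm ?_)
  refine (congrArg (fun l : F →L[ℝ] E ↦ l (localRep x W z)) h4).trans ?_
  have h6 := mfderiv_localRep x W hzt
  refine (congrArg (fun v : F ↦
    (mfderiv 𝓘(ℝ, F) 𝓘(ℝ, E) (extChartAt 𝓘(ℝ, E) (f x) ∘ f) y : F →L[ℝ] E) v) h6).trans ?_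
  exact congrArg (fun l : F →L[ℝ] E ↦ l (W y)) h5

lemma contMDiff_push (hf : ContMDiff 𝓘(ℝ, F) 𝓘(ℝ, E) ∞ f) {W : ∀ y : M, TangentSpace 𝓘(ℝ, F) y}
    (hW : ContMDiff 𝓘(ℝ, F) (𝓘(ℝ, F).prod 𝓘(ℝ, F)) ∞
      (fun x ↦ (⟨x, W x⟩ : TangentBundle 𝓘(ℝ, F) M))) :
    ContMDiff 𝓘(ℝ, F) (𝓘(ℝ, E).prod 𝓘(ℝ, E)) ∞
      (fun y ↦ (⟨f y, push (E := E) f W y⟩ : TangentBundle 𝓘(ℝ, E) N)) :=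
  (hf.contMDiff_tangentMap (m := ∞) (by simp)).comp hW

/-- The Levi-Civita connection is torsion-free along `f`. -/
lemma SemiRiemannianMetric.push_mlieBracket [FiniteDimensional ℝ E] [CompleteSpace F]
    (g : SemiRiemannianMetric (E := E) N)
    (hf : ContMDiff 𝓘(ℝ, F) 𝓘(ℝ, E) ∞ f) {W U : ∀ y : M, TangentSpace 𝓘(ℝ, F) y}
    (hW : ContMDiff 𝓘(ℝ, F) (𝓘(ℝ, F).prod 𝓘(ℝ, F)) ∞
      (fun x ↦ (⟨x, W x⟩ : TangentBundle 𝓘(ℝ, F) M)))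
    (hU : ContMDiff 𝓘(ℝ, F) (𝓘(ℝ, F).prod 𝓘(ℝ, F)) ∞
      (fun x ↦ (⟨x, U x⟩ : TangentBundle 𝓘(ℝ, F) M))) (x : M) :
    push (E := E) f (VectorField.mlieBracket 𝓘(ℝ, F) W U) x =
      g.nablaAlong f (push (E := E) f U) x (W x) - g.nablaAlong f (push (E := E) f W) x (U x) := by
  set z := extChartAt 𝓘(ℝ, F) x x with hz
  set ψ : F → E := extChartAt 𝓘(ℝ, E) (f x) ∘ f ∘ (extChartAt 𝓘(ℝ, F) x).symm with hψ
  have hψs : ContDiffAt ℝ 2 ψ z := by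
    have := (contMDiffAt_iff.1 (hf x)).2
    rw [ModelWithCorners.range_eq_univ, contDiffWithinAt_univ] at this
    exact this.of_le (WithTop.coe_le_coe.2 le_top)
  have hdψ : (fderiv ℝ ψ z : F →L[ℝ] E) = mfderiv 𝓘(ℝ, F) 𝓘(ℝ, E) f x := by
    refine Eq.symm ((hf.mdifferentiableAt (x := x) (by simp)).mfderiv.trans ?_)
    refine (congrArg (fun s ↦ fderivWithin ℝ ψ s z)
      (ModelWithCorners.range_eq_univ 𝓘(ℝ, F))).trans ?_
    exact congrFun fderivWithin_univ _
  have hder : ∀ V : ∀ y : M, TangentSpace 𝓘(ℝ, F) y,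
      ContMDiff 𝓘(ℝ, F) (𝓘(ℝ, F).prod 𝓘(ℝ, F)) ∞
        (fun x ↦ (⟨x, V x⟩ : TangentBundle 𝓘(ℝ, F) M)) →
      (mvfderiv 𝓘(ℝ, F) (fun y ↦ coord (f x) (f y) (push (E := E) f V y)) x : F →L[ℝ] E) =
        fderiv ℝ (fun y ↦ fderiv ℝ ψ y (localRep x V y)) z := by
    intro V hV
    rw [mvfderiv_eq_fderiv_chart
      ((contMDiffAt_coord (contMDiff_push hf hV x)).mdifferentiableAt (by simp)),
      (coord_push_eq hf x V).fderiv_eq]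
  have key := fderiv_fderiv_apply_sub hψs (differentiableAt_localRep x (hW x))
    (differentiableAt_localRep x (hU x))
  rw [← hder U hU, ← hder W hW, localRep_self, localRep_self, ← mlieBracket_eq_localRep,
    hdψ] at key
  refine key.symm.trans ?_
  unfold nablaAlong
  -- The coordinate derivatives already account for the bracket; the two Christoffel terms agree and
  -- drop out of the difference.
  have hsym := g.christoffel_comm (f x) (mfderiv 𝓘(ℝ, F) 𝓘(ℝ, E) f x (W x))
    (mfderiv 𝓘(ℝ, F) 𝓘(ℝ, E) f x (U x))
  unfold push at hsym ⊢
  rw [hsym]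
  exact (add_sub_add_right_eq_sub _ _ _).symm

end Torsion

end GoldenLightlike
end

noncomputable section

namespace GoldenLightlike

/-! ### Projections of an internal direct sum -/

section Component

variable {V : Type*} [AddCommGroup V] [Module ℝ V] {A : Piece → Submodule ℝ V}
  (h : DirectSum.IsInternal A)

lemma component_add (i : Piece) (v w : V) :
    component h i (v + w) = component h i v + component h i w := by
  simp [component]

lemma component_sub (i : Piece) (v w : V) :
    component h i (v - w) = component h i v - component h i w := by
  simp [component]

lemma component_eq_coe_of {j : Piece} (i : Piece) {v : V} (hv : v ∈ A j) :
    component h i v = (DirectSum.of (fun i ↦ A i) j ⟨v, hv⟩ i : A i) := by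
  have : (LinearEquiv.ofBijective (DirectSum.coeLinearMap A)
      (show Function.Bijective _ from h)).symm v = DirectSum.of (fun i ↦ A i) j ⟨v, hv⟩ := by
    rw [LinearEquiv.symm_apply_eq]
    exact (DirectSum.coeAddMonoidHom_of A j ⟨v, hv⟩).symm
  rw [component, this]

lemma component_of_mem {i : Piece} {v : V} (hv : v ∈ A i) : component h i v = v := by
  rw [component_eq_coe_of h i hv, DirectSum.of_eq_same]

lemma component_of_mem_of_ne {i j : Piece} {v : V} (hv : v ∈ A j) (hij : j ≠ i) :
    component h i v = 0 := by
  rw [component_eq_coe_of h i hv, DirectSum.of_eq_of_ne _ _ _ hij.symm]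
  rfl

end Component

/-! ### The decomposition of the ambient bundle -/

section Submanifold

variable {E : Type*} [NormedAddCommGroup E] [NormedSpace ℝ E]
  {N : Type*} [TopologicalSpace N] [ChartedSpace E N] [IsManifold 𝓘(ℝ, E) ∞ N]
  {F : Type*} [NormedAddCommGroup F] [NormedSpace ℝ F]
  {M : Type*} [TopologicalSpace M] [ChartedSpace F M]
  {g : SemiRiemannianMetric (E := E) N} {f : M → N}

/-- `P² = P + I` makes `P - I` an inverse of `P`. -/
lemma GoldenStructure.eq_zero_of_apply_eq_zero (P : GoldenStructure g) {p : N}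
    {v : TangentSpace 𝓘(ℝ, E) p} (hv : P.toFun p v = 0) : v = 0 := by
  have h := P.golden p v
  rw [hv, map_zero, zero_add] at h
  exact h.symm

lemma GoldenStructure.injective (P : GoldenStructure g) (p : N) :
    Function.Injective (P.toFun p) :=
  (injective_iff_map_eq_zero _).2 fun _ ↦ P.eq_zero_of_apply_eq_zero

namespace LightlikeSubmanifold

variable (L : LightlikeSubmanifold (F := F) g f) {P : GoldenStructure g}

lemma comp_add (x : M) (i : Piece) (v w : TangentSpace 𝓘(ℝ, E) (f x)) :
    L.comp x i (v + w) = L.comp x i v + L.comp x i w :=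
  component_add _ _ _ _

lemma comp_sub (x : M) (i : Piece) (v w : TangentSpace 𝓘(ℝ, E) (f x)) :
    L.comp x i (v - w) = L.comp x i v - L.comp x i w :=
  component_sub _ _ _ _

lemma comp_screen_mem (x : M) (v : TangentSpace 𝓘(ℝ, E) (f x)) :
    L.comp x .screen v ∈ L.screen x :=
  component_mem (L.isInternal x) .screen v

lemma comp_rad_mem (x : M) (v : TangentSpace 𝓘(ℝ, E) (f x)) :
    L.comp x .rad v ∈ radical (F := F) g f x :=
  component_mem (L.isInternal x) .rad v

lemma comp_ltr_mem (x : M) (v : TangentSpace 𝓘(ℝ, E) (f x)) : L.comp x .ltr v ∈ L.ltr x :=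
  component_mem (L.isInternal x) .ltr v

lemma comp_screenTrans_mem (x : M) (v : TangentSpace 𝓘(ℝ, E) (f x)) :
    L.comp x .screenTrans v ∈ L.screenTrans x :=
  component_mem (L.isInternal x) .screenTrans v

lemma comp_sum (x : M) (v : TangentSpace 𝓘(ℝ, E) (f x)) :
    L.comp x .screen v + L.comp x .rad v + L.comp x .ltr v + L.comp x .screenTrans v = v :=
  component_sum (L.isInternal x) v

lemma comp_of_mem_screen {x : M} {v : TangentSpace 𝓘(ℝ, E) (f x)} (hv : v ∈ L.screen x)
    {i : Piece} (hi : Piece.screen ≠ i) : L.comp x i v = 0 :=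
  component_of_mem_of_ne (L.isInternal x) (j := .screen) hv hi

lemma comp_of_mem_rad {x : M} {v : TangentSpace 𝓘(ℝ, E) (f x)}
    (hv : v ∈ radical (F := F) g f x) {i : Piece} (hi : Piece.rad ≠ i) : L.comp x i v = 0 :=
  component_of_mem_of_ne (L.isInternal x) (j := .rad) hv hi

lemma comp_of_mem_ltr {x : M} {v : TangentSpace 𝓘(ℝ, E) (f x)} (hv : v ∈ L.ltr x)
    {i : Piece} (hi : Piece.ltr ≠ i) : L.comp x i v = 0 :=
  component_of_mem_of_ne (L.isInternal x) (j := .ltr) hv hi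

lemma comp_of_mem_screenTrans {x : M} {v : TangentSpace 𝓘(ℝ, E) (f x)}
    (hv : v ∈ L.screenTrans x) {i : Piece} (hi : Piece.screenTrans ≠ i) : L.comp x i v = 0 :=
  component_of_mem_of_ne (L.isInternal x) (j := .screenTrans) hv hi

lemma comp_rad_of_mem {x : M} {v : TangentSpace 𝓘(ℝ, E) (f x)}
    (hv : v ∈ radical (F := F) g f x) : L.comp x .rad v = v :=
  component_of_mem (L.isInternal x) (i := .rad) hv

lemma comp_ltr_of_mem {x : M} {v : TangentSpace 𝓘(ℝ, E) (f x)} (hv : v ∈ L.ltr x) :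
    L.comp x .ltr v = v :=
  component_of_mem (L.isInternal x) (i := .ltr) hv

lemma inner_screenTrans_tangent {x : M} {z t : TangentSpace 𝓘(ℝ, E) (f x)}
    (hz : z ∈ L.screenTrans x) (ht : t ∈ tangent (F := F) f x) : g.inner (f x) z t = 0 := by
  have : z ∈ normal (F := F) g f x := by
    rw [← L.radical_sup_screenTrans x]
    exact Submodule.mem_sup_right hz
  exact this t ht

lemma screen_le_tangent (x : M) : L.screen x ≤ tangent (F := F) f x := by
  rw [← L.radical_sup_screen x]
  exact le_sup_right

/-- `screenTrans` is the orthogonal complement of `screen ⊕ Rad ⊕ ltr`. -/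
lemma mem_screenTrans_of_orthogonal {x : M} {v : TangentSpace 𝓘(ℝ, E) (f x)}
    (ht : ∀ t ∈ tangent (F := F) f x, g.inner (f x) v t = 0)
    (hl : ∀ n ∈ L.ltr x, g.inner (f x) v n = 0) : v ∈ L.screenTrans x := by
  have hz := L.comp_screenTrans_mem x v
  set z := L.comp x .screenTrans v with hz_def
  have hsum := L.comp_sum x v
  rw [← hz_def] at hsum
  have hzt : ∀ t ∈ tangent (F := F) f x, g.inner (f x) (v - z) t = 0 := by
    intro t h
    rw [map_sub]
    refine (congrArg₂ (· - ·) (ht t h) (L.inner_screenTrans_tangent hz h)).trans (sub_zero 0)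
  have hzl : ∀ n ∈ L.ltr x, g.inner (f x) (v - z) n = 0 := by
    intro n h
    rw [map_sub]
    refine (congrArg₂ (· - ·) (hl n h)
      ((g.symm _ _ _).trans (L.ltr_orthogonal_screenTrans x n h z hz))).trans (sub_zero 0)
  have hzz : ∀ y ∈ L.screenTrans x, g.inner (f x) (v - z) y = 0 := by
    intro y hy
    have : v - z = L.comp x .screen v + L.comp x .rad v + L.comp x .ltr v := by
      rw [sub_eq_iff_eq_add]; exact hsum.symm
    rw [this, g.symm, map_add, map_add,
      L.inner_screenTrans_tangent hy (L.screen_le_tangent x (L.comp_screen_mem x v)),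
      L.inner_screenTrans_tangent hy (L.comp_rad_mem x v).1, g.symm,
      L.ltr_orthogonal_screenTrans x _ (L.comp_ltr_mem x v) y hy]
    simp
  -- The vector `v - z` is orthogonal to all four summands, hence zero by nondegeneracy.
  have h0 : v - z = 0 := by
    refine g.nondegenerate _ _ fun w ↦ ?_
    rw [← L.comp_sum x w, map_add, map_add, map_add,
      hzt _ (L.screen_le_tangent x (L.comp_screen_mem x w)), hzt _ (L.comp_rad_mem x w).1,
      hzl _ (L.comp_ltr_mem x w), hzz _ (L.comp_screenTrans_mem x w)]
    simp
  rw [sub_eq_zero.1 h0]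
  exact hz

/-! ### Action of the Golden structure on the four summands -/

namespace IsRadicalTransversal

variable {L} (hL : L.IsRadicalTransversal P)
include hL

lemma apply_rad_mem {x : M} {v : TangentSpace 𝓘(ℝ, E) (f x)}
    (hv : v ∈ radical (F := F) g f x) : P.toFun (f x) v ∈ L.ltr x := by
  rw [← (hL x).1]
  exact Submodule.mem_map_of_mem hv

lemma apply_screen_mem {x : M} {v : TangentSpace 𝓘(ℝ, E) (f x)}
    (hv : v ∈ L.screen x) : P.toFun (f x) v ∈ L.screen x := by
  have := Submodule.mem_map_of_mem (f := (P.toFun (f x)).toLinearMap) hv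
  rwa [(hL x).2] at this

lemma exists_rad {x : M} {n : TangentSpace 𝓘(ℝ, E) (f x)} (hn : n ∈ L.ltr x) :
    ∃ ξ ∈ radical (F := F) g f x, P.toFun (f x) ξ = n := by
  rw [← (hL x).1] at hn
  exact hn

/-- `P` is self-adjoint and preserves `screen ⊕ Rad ⊕ ltr`, so it preserves everything orthogonal to
that sum. -/
lemma apply_screenTrans_mem {x : M} {z : TangentSpace 𝓘(ℝ, E) (f x)}
    (hz : z ∈ L.screenTrans x) : P.toFun (f x) z ∈ L.screenTrans x := by
  have hzl : ∀ n ∈ L.ltr x, g.inner (f x) z n = 0 := fun n hn ↦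
    (g.symm _ _ _).trans (L.ltr_orthogonal_screenTrans x n hn z hz)
  refine L.mem_screenTrans_of_orthogonal (fun t ht ↦ ?_) fun n hn ↦ ?_
  · rw [← L.radical_sup_screen x] at ht
    obtain ⟨ξ, hξ, s, hs, rfl⟩ := Submodule.mem_sup.1 ht
    rw [P.compatible, map_add, map_add, hzl _ (hL.apply_rad_mem hξ),
      L.inner_screenTrans_tangent hz (L.screen_le_tangent x (hL.apply_screen_mem hs))]
    simp
  -- Pairing with `P(Pξ) = Pξ + ξ` leaves one `ltr` and one radical term, both orthogonal to `z`.
  · obtain ⟨ξ, hξ, rfl⟩ := hL.exists_rad hn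
    rw [P.compatible, P.golden, map_add, hzl _ hn, L.inner_screenTrans_tangent hz hξ.1]
    simp

/-- The radical and lightlike transversal components of `P v`. -/
lemma comp_apply (x : M) (v : TangentSpace 𝓘(ℝ, E) (f x)) :
    P.toFun (f x) (L.comp x .rad (P.toFun (f x) v)) = L.comp x .ltr v ∧
      L.comp x .ltr (P.toFun (f x) v) = P.toFun (f x) (L.comp x .rad v) + L.comp x .ltr v := by
  obtain ⟨ξ, hξ, hn⟩ := hL.exists_rad (L.comp_ltr_mem x v)
  have hs := hL.apply_screen_mem (L.comp_screen_mem x v)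
  have hr := hL.apply_rad_mem (L.comp_rad_mem x v)
  have hz := hL.apply_screenTrans_mem (L.comp_screenTrans_mem x v)
  have hl := L.comp_ltr_mem x v
  -- The `ltr` part of `v` is `Pξ`; its image `Pξ + ξ` is the only source of a radical component in
  -- `P v`.
  have e : P.toFun (f x) v = P.toFun (f x) (L.comp x .screen v) + P.toFun (f x) (L.comp x .rad v)
      + (L.comp x .ltr v + ξ) + P.toFun (f x) (L.comp x .screenTrans v) := by
    conv_lhs => rw [← L.comp_sum x v]
    rw [map_add, map_add, map_add]
    have hg := P.golden (f x) ξ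
    rw [hn] at hg
    rw [hg]
  constructor
  · rw [e]
    simp only [comp_add]
    rw [L.comp_of_mem_screen hs (by decide), L.comp_of_mem_ltr hr (by decide),
      L.comp_of_mem_ltr hl (by decide), L.comp_rad_of_mem hξ,
      L.comp_of_mem_screenTrans hz (by decide)]
    simpa using hn
  · rw [e]
    simp only [comp_add]
    rw [L.comp_of_mem_screen hs (by decide), L.comp_ltr_of_mem hr,
      L.comp_ltr_of_mem hl, L.comp_of_mem_rad hξ (by decide),
      L.comp_of_mem_screenTrans hz (by decide)]
    simp

/-- On a nonempty submanifold `P ltr` always has an `ltr` part. -/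
lemma isEmpty_of_noLtrComponent (h : L.NoLtrComponent P) : IsEmpty M := by
  refine ⟨fun x ↦ ?_⟩
  obtain ⟨u, hu, s, -, hs⟩ := L.radical_smooth x
  obtain ⟨hli, hspan⟩ := hs x (mem_of_mem_nhds hu)
  let i : Fin L.r := ⟨0, L.one_le_r⟩
  have hξ : s i x ∈ radical (F := F) g f x := by
    rw [← hspan]
    exact Submodule.subset_span ⟨i, rfl⟩
  have hn := hL.apply_rad_mem hξ
  have h1 := h x _ hn
  rw [(hL.comp_apply x _).2, L.comp_of_mem_ltr hn (by decide), map_zero, zero_add,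
    L.comp_ltr_of_mem hn] at h1
  exact hli.ne_zero i (P.eq_zero_of_apply_eq_zero h1)

end IsRadicalTransversal

/-! ### Second fundamental forms and the screen equation -/

variable [FiniteDimensional ℝ E]

lemma hl_mem (V : ∀ x, TangentSpace 𝓘(ℝ, E) (f x)) (x : M) (w : TangentSpace 𝓘(ℝ, F) x) :
    L.hl V x w ∈ L.ltr x :=
  L.comp_ltr_mem x _

lemma hstar_eq (V : ∀ x, TangentSpace 𝓘(ℝ, E) (f x)) (x : M) (w : TangentSpace 𝓘(ℝ, F) x) :
    L.hstar V x w = L.comp x .rad (g.nablaAlong f V x w) := by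
  rw [hstar, nabla, comp_add, L.comp_of_mem_screen (L.comp_screen_mem x _) (by decide),
    L.comp_rad_of_mem (L.comp_rad_mem x _), zero_add]

variable [IsManifold 𝓘(ℝ, F) ∞ M]

/-- `h^*(W, U) = 0` for all `W, U ∈ Γ(screen)`. -/
def ScreenRadicalFlat : Prop :=
  ∀ W : ∀ x : M, TangentSpace 𝓘(ℝ, F) x,
    ContMDiff 𝓘(ℝ, F) (𝓘(ℝ, F).prod 𝓘(ℝ, F)) ∞
      (fun x ↦ (⟨x, W x⟩ : TangentBundle 𝓘(ℝ, F) M)) →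
    (∀ x, push (E := E) f W x ∈ L.screen x) →
    ∀ U, IsSection (F := F) f L.screen U → ∀ x, L.hstar U x (W x) = 0

/-- By vanishing torsion, the radical part of a bracket of screen fields is a difference of two
values of `h^*`, so involutivity comes for free once `h^*` vanishes. -/
lemma screenDefinesTotallyGeodesicFoliation_iff [CompleteSpace F] :
    L.ScreenDefinesTotallyGeodesicFoliation ↔ L.ScreenRadicalFlat := by
  constructor
  · intro h W hW hWS U hU x
    exact L.comp_of_mem_screen (h.2 W hW hWS U hU x) (by decide)
  · intro h
    refine ⟨fun W U hW hU hWS hUS x ↦ ?_, fun W hW hWS U hU x ↦ ?_⟩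
    · have hf := L.immersion.contMDiff
      have hr : L.comp x .rad (push (E := E) f (VectorField.mlieBracket 𝓘(ℝ, F) W U) x) = 0 := by
        rw [g.push_mlieBracket hf hW hU x, comp_sub, ← hstar_eq, ← hstar_eq,
          h W hW hWS _ ⟨contMDiff_push hf hU, hUS⟩ x, h U hU hUS _ ⟨contMDiff_push hf hW, hWS⟩ x,
          sub_zero]
      have ht : push (E := E) f (VectorField.mlieBracket 𝓘(ℝ, F) W U) x ∈
          tangent (F := F) f x := ⟨_, rfl⟩
      rw [← L.radical_sup_screen x] at ht
      obtain ⟨ξ, hξ, s, hs, e⟩ := Submodule.mem_sup.1 ht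
      rw [← e, comp_add, L.comp_rad_of_mem hξ, L.comp_of_mem_screen hs (by decide),
        add_zero] at hr
      rw [← e, hr, zero_add]
      exact hs
    · have h0 := h W hW hWS U hU x
      rw [hstar_eq] at h0
      rw [nabla, h0, add_zero]
      exact L.comp_screen_mem x _

namespace IsRadicalTransversal

variable {L}

omit [FiniteDimensional ℝ E] [IsManifold 𝓘(ℝ, F) ∞ M] in
lemma isSection_apply (hL : L.IsRadicalTransversal P) {U : ∀ x, TangentSpace 𝓘(ℝ, E) (f x)}
    (hU : IsSection (F := F) f L.screen U) :
    IsSection (F := F) f L.screen (fun y ↦ P.toFun (f y) (U y)) :=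
  ⟨P.contMDiff_apply L.immersion.contMDiff hU.1, fun x ↦ hL.apply_screen_mem (hU.2 x)⟩

omit [IsManifold 𝓘(ℝ, F) ∞ M] in
/-- `h^*(W, PU)` and `h^l(W, PU)` in terms of `h^*(W, U)` and `h^l(W, U)`. -/
lemma apply_hstar_apply (hL : L.IsRadicalTransversal P) (hP : P.IsLocallyGolden)
    {U : ∀ x, TangentSpace 𝓘(ℝ, E) (f x)} (hU : IsSection (F := F) f L.screen U) (x : M)
    (w : TangentSpace 𝓘(ℝ, F) x) :
    P.toFun (f x) (L.hstar (fun y ↦ P.toFun (f y) (U y)) x w) = L.hl U x w ∧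
      L.hl (fun y ↦ P.toFun (f y) (U y)) x w = P.toFun (f x) (L.hstar U x w) + L.hl U x w := by
  simp only [hstar_eq, hl]
  rw [hP.nablaAlong_apply L.immersion.contMDiff.contMDiffAt hU.1.contMDiffAt]
  exact hL.comp_apply x _

/-- On `ltr` this `K` inverts `P`. After applying `P`, the equation for `U` reads `λ + (Pρ + λ) = Pρ
+ λ`, that is `λ = 0`. -/
lemma screenRadicalFlat_iff (hL : L.IsRadicalTransversal P) (hP : P.IsLocallyGolden) :
    L.ScreenRadicalFlat ↔
      L.ScreenEquation P (fun x n ↦ L.comp x .rad (P.toFun (f x) n)) := by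
  have hK : ∀ x, ∀ n ∈ L.ltr x, P.toFun (f x) (L.comp x .rad (P.toFun (f x) n)) = n :=
    fun x n hn ↦ (hL.comp_apply x n).1.trans (L.comp_ltr_of_mem hn)
  have key : ∀ U, IsSection (F := F) f L.screen U → ∀ x (w : TangentSpace 𝓘(ℝ, F) x),
      (L.hstar (fun y ↦ P.toFun (f y) (U y)) x w +
          L.comp x .rad (P.toFun (f x) (L.hl (fun y ↦ P.toFun (f y) (U y)) x w)) =
        L.hstar U x w + L.comp x .rad (P.toFun (f x) (L.hl U x w))) ↔ L.hl U x w = 0 := by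
    intro U hU x w
    obtain ⟨h1, h2⟩ := hL.apply_hstar_apply hP hU x w
    rw [← (P.injective (f x)).eq_iff, map_add, map_add, hK x _ (L.hl_mem _ x w),
      hK x _ (L.hl_mem _ x w), h1, h2, add_eq_right]
  constructor
  · intro h W hW hWS U hU x
    rw [key U hU, ← (hL.apply_hstar_apply hP hU x _).1, h W hW hWS _ (hL.isSection_apply hU),
      map_zero]
  · intro h W hW hWS U hU x
    have h1 := (key U hU x (W x)).1 (h W hW hWS U hU x)
    -- The equation for `PU` in place of `U` kills `h^l(W, PU) = Pρ + λ`; with `λ = 0` this gives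
    -- `Pρ = 0`.
    have h2 := (key _ (hL.isSection_apply hU) x (W x)).1 (h W hW hWS _ (hL.isSection_apply hU) x)
    rw [(hL.apply_hstar_apply hP hU x _).2, h1, add_zero] at h2
    exact P.eq_zero_of_apply_eq_zero h2

/-- Here `K` vanishes on `ltr`, so the equation for a single `U` only relates the two forms, as `λ =
Pρ`. -/
lemma screenRadicalFlat_iff' (hL : L.IsRadicalTransversal P) (hP : P.IsLocallyGolden) :
    L.ScreenRadicalFlat ↔ L.ScreenEquation P (fun x n ↦ L.comp x .rad n) := by
  have key : ∀ U, IsSection (F := F) f L.screen U → ∀ x (w : TangentSpace 𝓘(ℝ, F) x),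
      (L.hstar (fun y ↦ P.toFun (f y) (U y)) x w +
          L.comp x .rad (L.hl (fun y ↦ P.toFun (f y) (U y)) x w) =
        L.hstar U x w + L.comp x .rad (L.hl U x w)) ↔
      L.hl U x w = P.toFun (f x) (L.hstar U x w) := by
    intro U hU x w
    obtain ⟨h1, h2⟩ := hL.apply_hstar_apply hP hU x w
    rw [← (P.injective (f x)).eq_iff, map_add, map_add, h1,
      L.comp_of_mem_ltr (L.hl_mem _ x w) (by decide),
      L.comp_of_mem_ltr (L.hl_mem _ x w) (by decide), map_zero, add_zero, add_zero]
  constructor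
  · intro h W hW hWS U hU x
    rw [key U hU, ← (hL.apply_hstar_apply hP hU x _).1, h W hW hWS _ (hL.isSection_apply hU),
      h W hW hWS U hU]
  · intro h W hW hWS U hU x
    have h1 := (key U hU x (W x)).1 (h W hW hWS U hU x)
    -- For `PU` the relation becomes `Pρ + λ = λ`, which forces `ρ = 0`.
    have h2 := (key _ (hL.isSection_apply hU) x (W x)).1 (h W hW hWS _ (hL.isSection_apply hU) x)
    obtain ⟨h3, h4⟩ := hL.apply_hstar_apply hP hU x (W x)
    rw [h4, h3, add_eq_right] at h2
    exact P.eq_zero_of_apply_eq_zero h2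

end IsRadicalTransversal

end LightlikeSubmanifold

end Submanifold

end GoldenLightlike
end

theorem mainTheorem8
    {E : Type*} [NormedAddCommGroup E] [NormedSpace ℝ E] [FiniteDimensional ℝ E]
    {N : Type*} [TopologicalSpace N] [T2Space N] [SecondCountableTopology N]
    [ChartedSpace E N] [IsManifold 𝓘(ℝ, E) ∞ N]
    {F : Type*} [NormedAddCommGroup F] [NormedSpace ℝ F] [FiniteDimensional ℝ F]
    {M : Type*} [TopologicalSpace M] [T2Space M] [SecondCountableTopology M]
    [ChartedSpace F M] [IsManifold 𝓘(ℝ, F) ∞ M]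
    (g : GoldenLightlike.SemiRiemannianMetric (E := E) N)
    (P : GoldenLightlike.GoldenStructure g) (hP : P.IsLocallyGolden)
    (f : M → N) (L : GoldenLightlike.LightlikeSubmanifold (F := F) g f)
    (hL : L.IsRadicalTransversal P) :
    -- `K₂ h^l` read as the radical component of `P h^l`
    (L.ScreenDefinesTotallyGeodesicFoliation ↔
      L.NoLtrComponent P ∨
        L.ScreenEquation P (fun x n ↦ L.comp x .rad (P.toFun (f x) n))) ∧
    -- `K₂ h^l` read as the radical component of `h^l` itself
    (L.ScreenDefinesTotallyGeodesicFoliation ↔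
      L.NoLtrComponent P ∨
        L.ScreenEquation P (fun x n ↦ L.comp x .rad n)) := by
  have : CompleteSpace F := FiniteDimensional.complete ℝ F
  -- Condition (a) leaves no point at which anything has to be checked.
  have ha : L.NoLtrComponent P → L.ScreenRadicalFlat := fun h _ _ _ _ _ x ↦
    ((hL.isEmpty_of_noLtrComponent h).false x).elim
  rw [L.screenDefinesTotallyGeodesicFoliation_iff, ← hL.screenRadicalFlat_iff hP,
    ← hL.screenRadicalFlat_iff' hP]
  exact ⟨⟨Or.inr, fun h ↦ h.elim ha id⟩, ⟨Or.inr, fun h ↦ h.elim ha id⟩⟩
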